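/- Let $P$ be a probability distribution on $\mathcal X\times\mathbb R$ such that $Y\in[0,1]$ almost surely when $(X,Y)\sim P$, and let $f:\mathcal X\to[0,1]$ be a fixed measurable function. For a measurable $g:\mathcal X\to[0,1]$, define its Cutoff Calibration Error under $P$ by $$\Delta_{\mathrm{Cutoff}}^P(g)=\sup_{I\subseteq\mathbb R\text{ an interval}}\Big|\mathbb E_{(X,Y)\sim P}\big[(Y-g(X))\,\mathbf 1\{g(X)\in I\}\big]\Big|.$$ Let $n\ge 1$ and let $(X_1,Y_1),\dots,(X_n,Y_n)$ be i.i.d. with distribution $P$. An isotonic regression of the $Y_i$ on the $f(X_i)$ is a non-decreasing function $h:[0,1]\to[0,1]$ such that $\sum_{i=1}^n (Y_i-h(f(X_i)))^2\le\sum_{i=1}^n (Y_i-g(f(X_i)))^2$ for every non-decreasing $g:[0,1]\to\mathbb R$. (Its values are determined only at the points $f(X_i)$; elsewhere any monotone extension with values in $[0,1]$ is allowed.) Then for every $\delta>0$, with probability at least $1-\delta$, every isotonic regression $h_n$ of the $Y_i$ on the $f(X_i)$ satisfies $$\Delta_{\mathrm{Cutoff}}^P(h_n\circ f)\le\frac{30+2\sqrt{2\log(2/\delta)}}{\sqrt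 n}.$$ (For $\delta\ge 1$ the claim is void. "With probability at least $1-\delta$" means that the inequality holds on a measurable event of probability at least $1-\delta$.) -/

import Mathlib

open MeasureTheory ProbabilityTheory

/-- Cutoff Calibration Error of a forecast `g : 𝒳 → ℝ` when `(X, Y)` has law `P`:
the supremum of `|𝔼_P[(Y - g(X)) 𝟙{g(X) ∈ I}]|` over all intervals `I` of the real line
(the order-connected sets: bounded or not, with or without either endpoint).
If `g` and `Y` take values in `[0, 1]`, then every term is at most `1`, so that the supremum
is a genuine one. -/
noncomputable def cutoffCalibrationError {𝒳 : Type*} [MeasurableSpace 𝒳]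
    (P : Measure (𝒳 × ℝ)) (g : 𝒳 → ℝ) : ℝ :=
  ⨆ I : {I : Set ℝ // I.OrdConnected},
    |∫ p : 𝒳 × ℝ, (p.2 - g p.1) * (I : Set ℝ).indicator (fun _ => (1 : ℝ)) (g p.1) ∂P|

/-- `h : [0, 1] → [0, 1]` is an isotonic regression of the responses `y i` on the predictors `z i`:
it is non-decreasing, and it minimizes the sum of squared residuals among all non-decreasing
real functions on `[0, 1]`. Its values are determined at the points `z i` only; between them,
every monotone interpolation is allowed. -/
structure IsIsotonicRegression {n : ℕ} (z : Fin n → unitInterval) (y : Fin n → ℝ)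
    (h : unitInterval → unitInterval) : Prop where
  monotone : Monotone h
  le_of_monotone : ∀ g : unitInterval → ℝ, Monotone g →
    ∑ i, (y i - (h (z i) : ℝ)) ^ 2 ≤ ∑ i, (y i - g (z i)) ^ 2

/-- Responses in `[0, 1]` always have an isotonic regression. -/
theorem exists_isIsotonicRegression {n : ℕ} (z : Fin n → unitInterval) (y : Fin n → ℝ)
    (hy : ∀ i, y i ∈ Set.Icc (0 : ℝ) 1) : ∃ h, IsIsotonicRegression z y h := by
  have hc : IsCompact {h : unitInterval → unitInterval | Monotone h} :=
    (isClosed_monotone (α := unitInterval) (β := unitInterval)).isCompact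
  have hcont : Continuous
      (fun h : unitInterval → unitInterval => ∑ i, (y i - (h (z i) : ℝ)) ^ 2) := by
    fun_prop
  obtain ⟨h, hm, hmin⟩ := hc.exists_isMinOn ⟨id, monotone_id⟩ hcont.continuousOn
  refine ⟨h, hm, fun g hg => ?_⟩
  have hk : Monotone (fun t => Set.projIcc (0 : ℝ) 1 zero_le_one (g t)) :=
    (Set.monotone_projIcc _).comp hg
  refine (hmin hk).trans (Finset.sum_le_sum fun i _ => ?_)
  obtain ⟨h0, h1⟩ := hy i
  simp only [Set.coe_projIcc]
  rcases le_total (g (z i)) 0 with a | a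
  · rw [min_eq_right (by linarith), max_eq_left a]
    nlinarith
  · rcases le_total (g (z i)) 1 with b | b
    · rw [min_eq_right b, max_eq_right a]
    · rw [min_eq_left b, max_eq_right zero_le_one]
      nlinarith

/-! An isotonic fit `h` is exactly calibrated on the sample: its residuals sum to zero over `{h ∘ f
∈ U}` for every upper set `U` (`IsIsotonicRegression.sum_residual_mul_indicator`). The population
error over such a set is therefore a pure sampling deviation. It involves two functions: `Y` on `{f
∈ V}`, where `V` is the preimage of `U` under `h`, and `G ∘ f`, where `G` is `h` cut off outside
`V`. Whatever `h` is, `V` is an upper set and `G` is monotone with values in `[0, 1]`, hence an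
average of indicators of upper sets. So the random choice of `h` costs nothing beyond a supremum
over half-lines (`tailDeviation`), once with weight `1` and once with weight `Y`. An interval is a
difference of two upper sets, which gives the factor 2 in `cutoffCalibrationError_le`.

Symmetrization reduces the mean of such a supremum to maxima of partial sums of signs, and Doob's
`L²` inequality bounds it by `4 / √n`, without chaining or a logarithmic factor
(`integral_tailDeviation_le`). McDiarmid's inequality supplies the fluctuation. The total is `(16 +
2√(2 log(2/δ))) / √n`, below the stated bound. -/

theorem integrable_of_abs_le {α : Type*} [MeasurableSpace α] {μ : Measure α} [IsFiniteMeasure μ]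
    {g : α → ℝ} (hg : Measurable g) {B : ℝ} (hB : ∀ x, |g x| ≤ B) : Integrable g μ :=
  Integrable.of_bound hg.aestronglyMeasurable B (Filter.Eventually.of_forall hB)

theorem abs_integral_le_of_abs_le {α : Type*} [MeasurableSpace α] {μ : Measure α}
    [IsProbabilityMeasure μ] {g : α → ℝ} {B : ℝ} (hB : ∀ x, |g x| ≤ B) : |∫ x, g x ∂μ| ≤ B := by
  simpa using norm_integral_le_of_norm_le_const (μ := μ) (f := g) (C := B)
    (Filter.Eventually.of_forall hB)

/-! ### McDiarmid's inequality -/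

/-- Exponential moments of a function of independent variables with bounded differences. -/
theorem integral_exp_sub_integral_le_of_bounded_differences {S : Type*} [MeasurableSpace S]
    (P : Measure S) [IsProbabilityMeasure P] {c B t : ℝ} {n : ℕ} {g : (Fin n → S) → ℝ}
    (hg : Measurable g) (hB : ∀ x, |g x| ≤ B)
    (hc : ∀ x i s, |g (Function.update x i s) - g x| ≤ c) :
    ∫ x, Real.exp (t * (g x - ∫ y, g y ∂Measure.pi fun _ => P)) ∂Measure.pi (fun _ => P) ≤
      Real.exp (n * (c / 2) ^ 2 * t ^ 2 / 2) := by
  induction n with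
  | zero =>
    have : ∀ x, g x = g default := fun x => by rw [Subsingleton.elim x default]
    simp [this]
  | succ n ih =>
    have hne : Nonempty S := nonempty_of_isProbabilityMeasure P
    let e := MeasurableEquiv.piFinSuccAbove (fun _ : Fin (n + 1) => S) 0
    have he : MeasurePreserving e (Measure.pi fun _ => P) (P.prod (Measure.pi fun _ => P)) :=
      measurePreserving_piFinSuccAbove (fun _ => P) 0
    let G : S × (Fin n → S) → ℝ := fun p => g (e.symm p)
    have hG : Measurable G := hg.comp e.symm.measurable
    have hgG : ∀ x, g x = G (e x) := fun x => by simp [G]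
    have hcons : ∀ s xs, e.symm (s, xs) = Fin.cons s xs := fun s xs => by
      simp [e, MeasurableEquiv.piFinSuccAbove, Fin.insertNthEquiv, Fin.insertNth_zero']
    -- The conditional mean given the first coordinate. It inherits the oscillation bound `c`, and
    -- each slice of `g` satisfies the induction hypothesis, so the exponential moment factors as in
    -- Doob's martingale.
    let g₁ : S → ℝ := fun s => ∫ xs, G (s, xs) ∂Measure.pi fun _ => P
    have hg₁ : Measurable g₁ :=
      (hG.stronglyMeasurable.integral_prod_right (ν := Measure.pi fun _ : Fin n => P)).measurable
    have hg₁B : ∀ s, |g₁ s| ≤ B := fun s => abs_integral_le_of_abs_le fun xs => hB _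
    have hGs : ∀ s, Measurable fun xs => G (s, xs) := fun s => hG.comp measurable_prodMk_left
    have hmean : ∫ y, g y ∂(Measure.pi fun _ => P) = ∫ s, g₁ s ∂P := by
      simp_rw [hgG]
      rw [he.integral_comp' G, integral_prod]
      exact integrable_of_abs_le hG fun p => hB _
    have hdiff : ∀ s s', |g₁ s' - g₁ s| ≤ c := by
      intro s s'
      have h1 : g₁ s' - g₁ s = ∫ xs, (G (s', xs) - G (s, xs)) ∂Measure.pi fun _ => P :=
        (integral_sub (integrable_of_abs_le (hGs s') fun _ => hB _)
          (integrable_of_abs_le (hGs s) fun _ => hB _)).symm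
      rw [h1]
      refine abs_integral_le_of_abs_le fun xs => ?_
      have := hc (Fin.cons s xs) 0 s'
      simpa only [G, hcons, Fin.update_cons_zero] using this
    have hpart : ∀ s, ∫ xs, Real.exp (t * (G (s, xs) - g₁ s)) ∂(Measure.pi fun _ => P) ≤
        Real.exp (n * (c / 2) ^ 2 * t ^ 2 / 2) := by
      intro s
      refine ih (hGs s) (fun _ => hB _) fun x i s' => ?_
      have := hc (Fin.cons s x) i.succ s'
      simpa only [G, hcons, Fin.cons_update] using this
    set m := ∫ s, g₁ s ∂P with hm
    -- Hoeffding's lemma: `g₁` takes its values in an interval of length `c` that starts at its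
    -- infimum.
    have hout : ∫ s, Real.exp (t * (g₁ s - m)) ∂P ≤ Real.exp ((c / 2) ^ 2 * t ^ 2 / 2) := by
      have hbdd : BddBelow (Set.range g₁) :=
        ⟨-B, by rintro _ ⟨s, rfl⟩; exact (abs_le.1 (hg₁B s)).1⟩
      have hIcc : ∀ s, g₁ s ∈ Set.Icc (⨅ s, g₁ s) ((⨅ s, g₁ s) + c) := fun s =>
        ⟨ciInf_le hbdd s, by
          rw [← sub_le_iff_le_add]
          exact le_ciInf fun s' => by linarith [(abs_le.1 (hdiff s' s)).2]⟩
      have := (hasSubgaussianMGF_of_mem_Icc (μ := P) hg₁.aemeasurable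
        (Filter.Eventually.of_forall hIcc)).mgf_le t
      simpa [mgf, div_pow] using this
    have hexpB : ∀ a b : ℝ, |a| ≤ B → |b| ≤ B → |Real.exp (t * (a - b))| ≤
        Real.exp (|t| * (B + B)) := by
      intro a b ha hb
      rw [abs_of_pos (Real.exp_pos _)]
      refine Real.exp_le_exp.2 ((le_abs_self _).trans ?_)
      rw [abs_mul]
      gcongr
      exact (abs_sub _ _).trans (add_le_add ha hb)
    have hmB : |m| ≤ B := abs_integral_le_of_abs_le hg₁B
    rw [hmean]
    simp_rw [hgG]
    rw [he.integral_comp' fun p => Real.exp (t * (G p - m)), integral_prod]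
    swap
    · exact integrable_of_abs_le (by fun_prop) fun p => hexpB _ _ (hB _) hmB
    calc ∫ s, ∫ xs, Real.exp (t * (G (s, xs) - m)) ∂(Measure.pi fun _ => P) ∂P
        = ∫ s, Real.exp (t * (g₁ s - m)) *
            ∫ xs, Real.exp (t * (G (s, xs) - g₁ s)) ∂(Measure.pi fun _ => P) ∂P := by
          congr 1 with s
          rw [← integral_const_mul]
          congr 1 with xs
          rw [← Real.exp_add]
          ring_nf
      _ ≤ ∫ s, Real.exp (t * (g₁ s - m)) * Real.exp (n * (c / 2) ^ 2 * t ^ 2 / 2) ∂P := by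
          have hi : Integrable (fun s => Real.exp (t * (g₁ s - m)) *
              Real.exp (n * (c / 2) ^ 2 * t ^ 2 / 2)) P :=
            (integrable_of_abs_le (by fun_prop) fun p => hexpB _ _ (hg₁B _) hmB).mul_const _
          refine integral_mono_of_nonneg (Filter.Eventually.of_forall fun s => ?_) hi
            (Filter.Eventually.of_forall fun s => ?_)
          · exact mul_nonneg (Real.exp_pos _).le (integral_nonneg fun _ => (Real.exp_pos _).le)
          · exact mul_le_mul_of_nonneg_left (hpart s) (Real.exp_pos _).le
      _ ≤ Real.exp ((c / 2) ^ 2 * t ^ 2 / 2) * Real.exp (n * (c / 2) ^ 2 * t ^ 2 / 2) := by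
          rw [integral_mul_const]
          gcongr
      _ = Real.exp ((n + 1 : ℕ) * (c / 2) ^ 2 * t ^ 2 / 2) := by
          rw [← Real.exp_add]
          push_cast
          ring_nf

/-- **McDiarmid's inequality**. -/
theorem measureReal_ge_le_of_bounded_differences {S : Type*} [MeasurableSpace S]
    (P : Measure S) [IsProbabilityMeasure P] {c B ε : ℝ} {n : ℕ} (hn : 0 < n) (hc0 : 0 < c)
    (hε : 0 ≤ ε) {g : (Fin n → S) → ℝ}
    (hg : Measurable g) (hB : ∀ x, |g x| ≤ B)
    (hc : ∀ x i s, |g (Function.update x i s) - g x| ≤ c) :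
    (Measure.pi fun _ => P).real {x | ε ≤ g x - ∫ y, g y ∂Measure.pi fun _ => P} ≤
      Real.exp (-(2 * ε ^ 2 / (n * c ^ 2))) := by
  have hn' : (0 : ℝ) < n := by exact_mod_cast hn
  -- The minimizer in `t` of the Chernoff exponent `-t ε + n (c / 2)² t² / 2`.
  have ht : 0 ≤ 4 * ε / (n * c ^ 2) := by positivity
  refine (measure_ge_le_exp_mul_mgf ε ht ?_).trans ?_
  · refine integrable_exp_mul_of_mem_Icc (a := -(B + B)) (b := B + B) (by fun_prop)
      (Filter.Eventually.of_forall fun x => ?_)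
    have h := abs_le.1 (hB x)
    have h' := abs_le.1 (abs_integral_le_of_abs_le (μ := Measure.pi fun _ => P) hB)
    constructor <;> linarith [h.1, h.2, h'.1, h'.2]
  · refine (mul_le_mul_of_nonneg_left (integral_exp_sub_integral_le_of_bounded_differences P
      hg hB hc) (Real.exp_pos _).le).trans_eq ?_
    rw [← Real.exp_add]
    congr 1
    field_simp
    ring

/-! ### Maximal inequality for Rademacher sums -/

/-- Burkholder's function for Doob's maximal inequality in `L²`. -/
theorem doob_potential_step {s m y : ℝ} (hm : |s| ≤ m) :
    (2 * max m |s + y| ^ 2 - 4 * max m |s + y| * |s + y| + 4 * (s + y) ^ 2) +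
      (2 * max m |s - y| ^ 2 - 4 * max m |s - y| * |s - y| + 4 * (s - y) ^ 2) ≤
    2 * (2 * m ^ 2 - 4 * m * |s| + 4 * s ^ 2) + 8 * y ^ 2 := by
  -- As a function of `m`, the quadratic `2 m² - 4 m |r|` is least at `m = |r|`, so raising `m` to
  -- the new maximum cannot increase it.
  have key : ∀ r : ℝ, 2 * max m |r| ^ 2 - 4 * max m |r| * |r| ≤ 2 * m ^ 2 - 4 * m * |r| := by
    intro r
    rcases le_total m |r| with h | h
    · rw [max_eq_right h]
      nlinarith [sq_nonneg (|r| - m)]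
    · rw [max_eq_left h]
  have hm0 : 0 ≤ m := (abs_nonneg s).trans hm
  have htri : 2 * |s| ≤ |s + y| + |s - y| := by
    have := abs_add_le (s + y) (s - y)
    rwa [show s + y + (s - y) = 2 * s by ring, abs_mul, abs_two] at this
  nlinarith [key (s + y), key (s - y), mul_le_mul_of_nonneg_left htri hm0]

/-- The maximal partial sum of a Rademacher sum, with its potential. -/
theorem exists_bound_signed_tail_sums {ι : Type*} [Fintype ι] [DecidableEq ι] (w z : ι → ℝ)
    (T : Finset ι) : ∃ M : (ι → ℤˣ) → ℝ,
      (∀ ε c, |∑ i ∈ T with c < z i, ((ε i : ℤ) : ℝ) * w i| ≤ M ε) ∧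
      (∀ ε, |∑ i ∈ T, ((ε i : ℤ) : ℝ) * w i| ≤ M ε) ∧
      (∀ ε ε' : ι → ℤˣ, (∀ i ∈ T, ε i = ε' i) → M ε = M ε') ∧
      ∑ ε, (2 * M ε ^ 2 - 4 * M ε * |∑ i ∈ T, ((ε i : ℤ) : ℝ) * w i| +
        4 * (∑ i ∈ T, ((ε i : ℤ) : ℝ) * w i) ^ 2) ≤
      Fintype.card (ι → ℤˣ) * (4 * ∑ i ∈ T, w i ^ 2) := by
  -- Indices enter in decreasing order of `z`, so each tail `{c < z}` is an initial segment and its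
  -- sum is one of the partial sums recorded by `M`.
  induction T using Finset.induction_on_min_value z with
  | empty => exact ⟨fun _ => 0, by simp, by simp, by simp, by simp⟩
  | insert a T ha hmin ih =>
    obtain ⟨M, hM, hMT, hdep, hsum⟩ := ih
    set s : (ι → ℤˣ) → ℝ := fun ε => ∑ i ∈ T, ((ε i : ℤ) : ℝ) * w i with hs
    refine ⟨fun ε => max (M ε) |∑ i ∈ insert a T, ((ε i : ℤ) : ℝ) * w i|, ?_,
      fun ε => le_max_right _ _, ?_, ?_⟩
    · intro ε c
      by_cases hc : c < z a
      · rw [Finset.filter_true_of_mem]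
        · exact le_max_right _ _
        · intro i hi
          rcases Finset.mem_insert.1 hi with rfl | hi
          · exact hc
          · exact hc.trans_le (hmin i hi)
      · rw [Finset.filter_insert, if_neg hc]
        exact (hM ε c).trans (le_max_left _ _)
    · intro ε ε' h
      have h1 := hdep ε ε' fun i hi => h i (Finset.mem_insert_of_mem hi)
      have h2 : ∑ i ∈ insert a T, ((ε i : ℤ) : ℝ) * w i =
          ∑ i ∈ insert a T, ((ε' i : ℤ) : ℝ) * w i :=
        Finset.sum_congr rfl fun i hi => by rw [h i hi]
      simp only [h1, h2]
    · set φ : (ι → ℤˣ) → ℝ := fun ε =>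
        2 * max (M ε) |∑ i ∈ insert a T, ((ε i : ℤ) : ℝ) * w i| ^ 2 -
        4 * max (M ε) |∑ i ∈ insert a T, ((ε i : ℤ) : ℝ) * w i| *
          |∑ i ∈ insert a T, ((ε i : ℤ) : ℝ) * w i| +
        4 * (∑ i ∈ insert a T, ((ε i : ℤ) : ℝ) * w i) ^ 2 with hφ
      -- Flipping the sign at `a` changes neither `M` nor the old sum `s`. Pairing `ε` with `σ ε`
      -- thus yields the increments `±w a` of the potential step.
      let σ : Equiv.Perm (ι → ℤˣ) := Equiv.mulLeft (Pi.mulSingle a (-1))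
      have hσT : ∀ ε, ∀ i ∈ T, σ ε i = ε i := fun ε i hi => by
        have : i ≠ a := fun h => ha (h ▸ hi)
        simp [σ, this]
      have hσa : ∀ ε, σ ε a = -ε a := fun ε => by simp [σ]
      have hstep : ∀ ε, φ ε + φ (σ ε) ≤
          2 * (2 * M ε ^ 2 - 4 * M ε * |s ε| + 4 * s ε ^ 2) + 8 * w a ^ 2 := by
        intro ε
        have h1 : M (σ ε) = M ε := hdep _ _ (hσT ε)
        have h2 : ∑ i ∈ T, ((σ ε i : ℤ) : ℝ) * w i = s ε :=
          Finset.sum_congr rfl fun i hi => by rw [hσT ε i hi]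
        have h3 : ∑ i ∈ T, ((ε i : ℤ) : ℝ) * w i = s ε := rfl
        simp only [hφ, h1, Finset.sum_insert ha, h2, h3, hσa]
        rcases Int.units_eq_one_or (ε a) with h | h
        · have := doob_potential_step (s := s ε) (y := w a) (hMT ε)
          simp only [h, Units.val_neg, Units.val_one, Int.cast_neg, Int.cast_one, neg_mul, one_mul]
          convert this using 2 <;> ring_nf
        · have := doob_potential_step (s := s ε) (y := -w a) (hMT ε)
          simp only [h, Units.val_neg, Units.val_one, Int.cast_neg, Int.cast_one, neg_mul, one_mul,
            neg_neg]
          convert this using 2 <;> ring_nf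
      have h2 : 2 * ∑ ε, φ ε = ∑ ε, (φ ε + φ (σ ε)) := by
        rw [Finset.sum_add_distrib (f := φ), Equiv.sum_comp σ φ, two_mul]
      have h3 : 2 * ∑ ε, φ ε ≤ 2 * ∑ ε, (2 * M ε ^ 2 - 4 * M ε * |s ε| + 4 * s ε ^ 2) +
          Fintype.card (ι → ℤˣ) * (8 * w a ^ 2) := by
        rw [h2]
        refine (Finset.sum_le_sum fun ε _ => hstep ε).trans_eq ?_
        rw [Finset.sum_add_distrib (g := fun _ => 8 * w a ^ 2), ← Finset.mul_sum, Finset.sum_const,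
          nsmul_eq_mul, Finset.card_univ]
      rw [Finset.sum_insert ha]
      linarith [h3, hsum]

/-- The expected maximum of the tails of a Rademacher sum with coefficients in `[-1, 1]`. -/
theorem exists_bound_signed_tails {n : ℕ} (w z : Fin n → ℝ) (hw : ∀ i, |w i| ≤ 1) :
    ∃ M : (Fin n → ℤˣ) → ℝ,
      (∀ ε c, |∑ i, ((ε i : ℤ) : ℝ) * (if c < z i then w i else 0)| ≤ M ε) ∧
      ∑ ε, M ε ≤ Fintype.card (Fin n → ℤˣ) * (2 * √n) := by
  obtain ⟨M, hM, -, -, hsum⟩ := exists_bound_signed_tail_sums w z Finset.univ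
  refine ⟨M, fun ε c => ?_, ?_⟩
  · convert hM ε c using 2
    rw [Finset.sum_filter]
    simp
  · set N : ℝ := ((Fintype.card (Fin n → ℤˣ) : ℕ) : ℝ) with hN
    have hsq : ∑ ε, M ε ^ 2 ≤ N * (4 * n) := by
      refine (Finset.sum_le_sum fun ε _ => ?_).trans (hsum.trans ?_)
      -- The potential equals `M² + (M - 2|s|)²`, so it dominates `M²`.
      · set s := ∑ i, ((ε i : ℤ) : ℝ) * w i
        nlinarith [sq_nonneg (M ε - 2 * |s|), sq_abs s]
      · gcongr
        calc ∑ i, w i ^ 2 ≤ ∑ _i : Fin n, (1 : ℝ) :=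
              Finset.sum_le_sum fun i _ => (sq_le_one_iff_abs_le_one _).2 (hw i)
          _ = n := by simp
    refine le_of_abs_le (abs_le_of_sq_le_sq ?_ (by positivity))
    calc (∑ ε, M ε) ^ 2 ≤ N * ∑ ε, M ε ^ 2 := by
          simpa [hN] using sq_sum_le_card_mul_sum_sq (s := Finset.univ) (f := M)
      _ ≤ N * (N * (4 * n)) := by gcongr
      _ = (N * (2 * √n)) ^ 2 := by
          rw [mul_pow, mul_pow, Real.sq_sqrt (Nat.cast_nonneg n)]
          ring

/-! ### Tail deviations and symmetrization -/

/-- The empirical mean of `g` minus its mean. -/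
noncomputable def empiricalDeviation {S : Type*} [MeasurableSpace S] (P : Measure S) (g : S → ℝ)
    {n : ℕ} (x : Fin n → S) : ℝ :=
  (∑ i, g (x i)) / n - ∫ s, g s ∂P

/-- The largest deviation of the empirical means of `w` over the strict upper level sets of `z`. -/
noncomputable def tailDeviation {S : Type*} [MeasurableSpace S] (P : Measure S) (w z : S → ℝ)
    {n : ℕ} (x : Fin n → S) : ℝ :=
  ⨆ c : ℚ, |empiricalDeviation P ((z ⁻¹' Set.Ioi (c : ℝ)).indicator w) x|

section

variable {S : Type*} {n : ℕ}

theorem abs_sum_div_le {a : Fin n → ℝ} (ha : ∀ i, |a i| ≤ 1) : |(∑ i, a i) / n| ≤ 1 := by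
  rw [abs_div, Nat.abs_cast]
  refine div_le_one_of_le₀ ((Finset.abs_sum_le_sum_abs _ _).trans ?_) (Nat.cast_nonneg n)
  exact (Finset.sum_le_sum fun i _ => ha i).trans_eq (by simp)

theorem abs_indicator_le_one {w : S → ℝ} (hw : ∀ s, w s ∈ Set.Icc (0 : ℝ) 1) (A : Set S) (s : S) :
    |A.indicator w s| ≤ 1 :=
  (Set.indicator_le_self' (fun _ _ => abs_nonneg _) s).trans' (by
    rw [← Real.norm_eq_abs, norm_indicator_eq_indicator_norm]; rfl) |>.trans
    (abs_le.2 ⟨by linarith [(hw s).1], (hw s).2⟩)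

theorem indicator_mem_Icc {w : S → ℝ} (hw : ∀ s, w s ∈ Set.Icc (0 : ℝ) 1) (A : Set S) (s : S) :
    A.indicator w s ∈ Set.Icc (0 : ℝ) 1 :=
  ⟨Set.indicator_nonneg (fun s _ => (hw s).1) s,
    (le_abs_self _).trans (abs_indicator_le_one hw A s)⟩

theorem abs_indicator_sub_le_one {w : S → ℝ} (hw : ∀ s, w s ∈ Set.Icc (0 : ℝ) 1) (A : Set S)
    (s t : S) : |A.indicator w s - A.indicator w t| ≤ 1 := by
  have h1 := indicator_mem_Icc hw A s
  have h2 := indicator_mem_Icc hw A t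
  exact abs_le.2 ⟨by linarith [h1.1, h2.2], by linarith [h1.2, h2.1]⟩

theorem indicator_Ioi_preimage (w z : S → ℝ) (c : ℝ) (s : S) :
    (z ⁻¹' Set.Ioi c).indicator w s = if c < z s then w s else 0 := by
  by_cases h : c < z s <;> simp [h]

/-- The largest difference of two empirical means over strict upper level sets. -/
noncomputable def pairedTailDeviation (w z : S → ℝ) (q : Fin n → S × S) : ℝ :=
  ⨆ c : ℚ, |(∑ i, ((z ⁻¹' Set.Ioi (c : ℝ)).indicator w (q i).1 -
    (z ⁻¹' Set.Ioi (c : ℝ)).indicator w (q i).2)) / n|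

theorem le_pairedTailDeviation {w : S → ℝ} (hw : ∀ s, w s ∈ Set.Icc (0 : ℝ) 1) (z : S → ℝ)
    (q : Fin n → S × S) (c : ℚ) :
    |(∑ i, ((z ⁻¹' Set.Ioi (c : ℝ)).indicator w (q i).1 -
      (z ⁻¹' Set.Ioi (c : ℝ)).indicator w (q i).2)) / n| ≤ pairedTailDeviation w z q :=
  le_ciSup (f := fun c : ℚ => |(∑ i, ((z ⁻¹' Set.Ioi (c : ℝ)).indicator w (q i).1 -
      (z ⁻¹' Set.Ioi (c : ℝ)).indicator w (q i).2)) / n|)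
    ⟨1, by rintro _ ⟨c, rfl⟩; exact abs_sum_div_le fun i => abs_indicator_sub_le_one hw _ _ _⟩ c

theorem abs_pairedTailDeviation_le_one {w : S → ℝ} (hw : ∀ s, w s ∈ Set.Icc (0 : ℝ) 1)
    (z : S → ℝ) (q : Fin n → S × S) : |pairedTailDeviation w z q| ≤ 1 := by
  rw [pairedTailDeviation, abs_of_nonneg (Real.iSup_nonneg fun c => abs_nonneg _)]
  exact ciSup_le fun c => abs_sum_div_le fun i => abs_indicator_sub_le_one hw _ _ _

/-- Exchange of the two members of each pair whose sign is negative. -/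
def signedSwap (ε : Fin n → ℤˣ) (q : Fin n → S × S) : Fin n → S × S :=
  fun i => if ε i = 1 then q i else (q i).swap

/-- A swap multiplies the `i`-th difference by `ε i`. The signed sum then splits into two Rademacher
tail sums, one ordered by the first members and one by the second, each with mean maximum at most
`2√n`. -/
theorem sum_pairedTailDeviation_signedSwap_le (hn : 0 < n) {w : S → ℝ}
    (hw : ∀ s, w s ∈ Set.Icc (0 : ℝ) 1) (z : S → ℝ) (q : Fin n → S × S) :
    ∑ ε, pairedTailDeviation w z (signedSwap ε q) ≤
      Fintype.card (Fin n → ℤˣ) * (4 / √n) := by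
  have hn' : (0 : ℝ) < n := by exact_mod_cast hn
  have hw' : ∀ s, |w s| ≤ 1 := fun s => abs_le.2 ⟨by linarith [(hw s).1], (hw s).2⟩
  obtain ⟨M₁, h₁, hs₁⟩ := exists_bound_signed_tails (fun i => w (q i).1) (fun i => z (q i).1)
    fun i => hw' _
  obtain ⟨M₂, h₂, hs₂⟩ := exists_bound_signed_tails (fun i => w (q i).2) (fun i => z (q i).2)
    fun i => hw' _
  have hle : ∀ ε, pairedTailDeviation w z (signedSwap ε q) ≤ (M₁ ε + M₂ ε) / n := by
    intro ε
    refine ciSup_le fun c => ?_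
    rw [abs_div, Nat.abs_cast]
    gcongr
    refine le_trans (le_of_eq ?_) ((abs_sub _ _).trans (add_le_add (h₁ ε c) (h₂ ε c)))
    rw [← Finset.sum_sub_distrib]
    congr 1
    refine Finset.sum_congr rfl fun i _ => ?_
    rw [← indicator_Ioi_preimage, ← indicator_Ioi_preimage]
    rcases Int.units_eq_one_or (ε i) with h | h
    · simp [signedSwap, h]
    · simp only [signedSwap, h, show (-1 : ℤˣ) ≠ 1 by decide, if_false, Prod.fst_swap, Prod.snd_swap]
      push_cast
      ring
  refine (Finset.sum_le_sum fun ε _ => hle ε).trans ?_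
  rw [← Finset.sum_div, Finset.sum_add_distrib, div_le_iff₀ hn']
  have h4 : 4 / √n * n = 4 * √n := by
    rw [div_mul_eq_mul_div, mul_div_assoc, Real.div_sqrt]
  rw [mul_assoc, h4]
  linarith

variable [MeasurableSpace S]

theorem measurable_pairedTailDeviation {w z : S → ℝ} (hwm : Measurable w) (hz : Measurable z) :
    Measurable fun q : Fin n → S × S => pairedTailDeviation w z q := by
  refine Measurable.iSup fun c => ?_
  have := hwm.indicator (hz (measurableSet_Ioi (a := (c : ℝ))))
  fun_prop

variable {P : Measure S}

theorem measurable_tailDeviation {w z : S → ℝ} (hwm : Measurable w) (hz : Measurable z) :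
    Measurable fun x : Fin n → S => tailDeviation P w z x := by
  refine Measurable.iSup fun c => ?_
  have := hwm.indicator (hz (measurableSet_Ioi (a := (c : ℝ))))
  unfold empiricalDeviation
  fun_prop

variable [IsProbabilityMeasure P]

theorem abs_empiricalDeviation_le_two {g : S → ℝ} (hg : ∀ s, |g s| ≤ 1) (x : Fin n → S) :
    |empiricalDeviation P g x| ≤ 2 := by
  refine (abs_sub _ _).trans ?_
  have h1 := abs_sum_div_le fun i => hg (x i)
  have h2 := abs_integral_le_of_abs_le (μ := P) hg
  linarith

theorem bddAbove_tailDeviation {w : S → ℝ} (hw : ∀ s, w s ∈ Set.Icc (0 : ℝ) 1) (z : S → ℝ)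
    (x : Fin n → S) : BddAbove (Set.range fun c : ℚ =>
      |empiricalDeviation P ((z ⁻¹' Set.Ioi (c : ℝ)).indicator w) x|) :=
  ⟨2, by rintro _ ⟨c, rfl⟩; exact abs_empiricalDeviation_le_two (abs_indicator_le_one hw _) x⟩

theorem abs_empiricalDeviation_le_tailDeviation {w : S → ℝ} (hw : ∀ s, w s ∈ Set.Icc (0 : ℝ) 1)
    (z : S → ℝ) (x : Fin n → S) (c : ℚ) :
    |empiricalDeviation P ((z ⁻¹' Set.Ioi (c : ℝ)).indicator w) x| ≤ tailDeviation P w z x :=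
  le_ciSup (bddAbove_tailDeviation hw z x) c

theorem abs_tailDeviation_le_two {w : S → ℝ} (hw : ∀ s, w s ∈ Set.Icc (0 : ℝ) 1) (z : S → ℝ)
    (x : Fin n → S) : |tailDeviation P w z x| ≤ 2 := by
  rw [tailDeviation, abs_of_nonneg (Real.iSup_nonneg fun c => abs_nonneg _)]
  exact ciSup_le fun c => abs_empiricalDeviation_le_two (abs_indicator_le_one hw _) x

/-- One new observation moves every empirical mean of a `[0, 1]`-valued function by at most `1 / n`,
and a supremum moves no more than its terms. -/
theorem abs_tailDeviation_update_sub_le {w : S → ℝ} (hw : ∀ s, w s ∈ Set.Icc (0 : ℝ) 1)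
    (z : S → ℝ) (x : Fin n → S) (i : Fin n) (s : S) :
    |tailDeviation P w z (Function.update x i s) - tailDeviation P w z x| ≤ 1 / n := by
  have hterm : ∀ c : ℚ, |empiricalDeviation P ((z ⁻¹' Set.Ioi (c : ℝ)).indicator w)
      (Function.update x i s) - empiricalDeviation P ((z ⁻¹' Set.Ioi (c : ℝ)).indicator w) x| ≤
      1 / n := by
    intro c
    set g := (z ⁻¹' Set.Ioi (c : ℝ)).indicator w
    have hsum : ∑ j, (g (Function.update x i s j) - g (x j)) = g s - g (x i) := by
      rw [Finset.sum_eq_single i]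
      · simp
      · intro j _ hj
        simp [hj]
      · simp
    have h1 := indicator_mem_Icc hw (z ⁻¹' Set.Ioi (c : ℝ)) s
    have h2 := indicator_mem_Icc hw (z ⁻¹' Set.Ioi (c : ℝ)) (x i)
    rw [empiricalDeviation, empiricalDeviation, sub_sub_sub_cancel_right, ← sub_div,
      ← Finset.sum_sub_distrib, hsum, abs_div, Nat.abs_cast]
    gcongr
    exact abs_le.2 ⟨by linarith [h1.1, h2.2], by linarith [h1.2, h2.1]⟩
  have hle : ∀ x x' : Fin n → S, (∀ c : ℚ, |empiricalDeviation P
      ((z ⁻¹' Set.Ioi (c : ℝ)).indicator w) x - empiricalDeviation P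
      ((z ⁻¹' Set.Ioi (c : ℝ)).indicator w) x'| ≤ 1 / n) →
      tailDeviation P w z x ≤ tailDeviation P w z x' + 1 / n := fun x x' hxx =>
    ciSup_le fun c => by
      have h1 := abs_empiricalDeviation_le_tailDeviation (P := P) hw z x' c
      have h2 := abs_sub_abs_le_abs_sub
        (empiricalDeviation P ((z ⁻¹' Set.Ioi (c : ℝ)).indicator w) x)
        (empiricalDeviation P ((z ⁻¹' Set.Ioi (c : ℝ)).indicator w) x')
      linarith [hxx c]
  rw [abs_sub_le_iff]
  constructor
  · linarith [hle _ _ hterm]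
  · linarith [hle x _ fun c => (abs_sub_comm _ _).trans_le (hterm c)]

/-- Comparison with an independent copy of the sample. -/
theorem tailDeviation_le_integral_pairedTailDeviation (hn : 0 < n) {w z : S → ℝ}
    (hw : ∀ s, w s ∈ Set.Icc (0 : ℝ) 1) (hwm : Measurable w) (hz : Measurable z)
    (x : Fin n → S) :
    tailDeviation P w z x ≤
      ∫ x', pairedTailDeviation w z (fun i => (x i, x' i)) ∂Measure.pi fun _ => P := by
  refine ciSup_le fun c => ?_
  set g := (z ⁻¹' Set.Ioi (c : ℝ)).indicator w with hg
  have hgm : Measurable g := hwm.indicator (hz measurableSet_Ioi)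
  have hg1 : ∀ s, |g s| ≤ 1 := abs_indicator_le_one hw _
  have hn' : (n : ℝ) ≠ 0 := by positivity
  have hmean : ∫ x', (∑ i, g (x' i)) / n ∂(Measure.pi fun _ : Fin n => P) = ∫ s, g s ∂P := by
    rw [integral_div, integral_finsetSum]
    · have : ∀ i : Fin n, ∫ x', g (x' i) ∂(Measure.pi fun _ : Fin n => P) = ∫ s, g s ∂P :=
        fun i => integral_comp_eval (μ := fun _ : Fin n => P) hgm.aestronglyMeasurable
      simp [this, hn']
    · exact fun i _ => integrable_of_abs_le (by fun_prop) fun x => hg1 (x i)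
  have hdev : empiricalDeviation P g x =
      ∫ x', (∑ i, (g (x i) - g (x' i))) / n ∂(Measure.pi fun _ : Fin n => P) := by
    have h2 : ∀ x' : Fin n → S, (∑ i, (g (x i) - g (x' i))) / n =
        (∑ i, g (x i)) / n - (∑ i, g (x' i)) / n := fun x' => by
      rw [Finset.sum_sub_distrib, sub_div]
    simp_rw [h2]
    rw [integral_sub (integrable_const _)
      (integrable_of_abs_le (g := fun x' : Fin n → S => (∑ i, g (x' i)) / n) (by fun_prop)
        fun x' => abs_sum_div_le fun i => hg1 (x' i)), hmean]
    simp [empiricalDeviation]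
  rw [hdev]
  refine abs_integral_le_integral_abs.trans ?_
  refine integral_mono_of_nonneg (Filter.Eventually.of_forall fun _ => abs_nonneg _) ?_
    (Filter.Eventually.of_forall fun x' => le_pairedTailDeviation hw z (fun i => (x i, x' i)) c)
  refine integrable_of_abs_le ?_ fun _ => abs_pairedTailDeviation_le_one hw z _
  exact (measurable_pairedTailDeviation hwm hz).comp (by fun_prop)

theorem measurePreserving_signedSwap (ε : Fin n → ℤˣ) :
    MeasurePreserving (signedSwap ε) (Measure.pi fun _ : Fin n => P.prod P)
      (Measure.pi fun _ : Fin n => P.prod P) := by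
  refine measurePreserving_pi (fun _ => P.prod P) (fun _ => P.prod P)
    (f := fun i p => if ε i = 1 then p else p.swap) fun i => ?_
  by_cases h : ε i = 1
  · simp only [h, if_true]
    exact MeasurePreserving.id (P.prod P)
  · simpa [h] using Measure.measurePreserving_swap (μ := P) (ν := P)

/-- Swaps within pairs preserve the law of the doubled sample, so the paired deviation may be
averaged over all signs; that average is bounded for each fixed sample. -/
theorem integral_tailDeviation_le (hn : 0 < n) {w z : S → ℝ}
    (hw : ∀ s, w s ∈ Set.Icc (0 : ℝ) 1) (hwm : Measurable w) (hz : Measurable z) :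
    ∫ x, tailDeviation P w z x ∂(Measure.pi fun _ : Fin n => P) ≤ 4 / √n := by
  set Q := Measure.pi fun _ : Fin n => P.prod P with hQ
  have hpm : Measurable fun q : Fin n → S × S => pairedTailDeviation w z q :=
    measurable_pairedTailDeviation hwm hz
  have hpB : ∀ q : Fin n → S × S, |pairedTailDeviation w z q| ≤ 1 :=
    abs_pairedTailDeviation_le_one hw z
  have hmp := measurePreserving_arrowProdEquivProdArrow S S (Fin n) (fun _ => P) (fun _ => P)
  have hcopy : ∫ x, tailDeviation P w z x ∂(Measure.pi fun _ : Fin n => P) ≤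
      ∫ q, pairedTailDeviation w z q ∂Q := by
    have h1 := hmp.integral_comp' fun p : (Fin n → S) × (Fin n → S) =>
      pairedTailDeviation w z fun i => (p.1 i, p.2 i)
    have hm : Measurable fun p : (Fin n → S) × (Fin n → S) =>
      pairedTailDeviation w z fun i => (p.1 i, p.2 i) := hpm.comp (by fun_prop)
    have h2 : Integrable (fun p : (Fin n → S) × (Fin n → S) =>
        pairedTailDeviation w z fun i => (p.1 i, p.2 i))
        ((Measure.pi fun _ => P).prod (Measure.pi fun _ => P)) :=
      integrable_of_abs_le hm fun _ => hpB _
    rw [integral_prod _ h2] at h1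
    refine le_trans ?_ h1.symm.le
    refine integral_mono (integrable_of_abs_le (measurable_tailDeviation hwm hz)
      (abs_tailDeviation_le_two hw z)) h2.integral_prod_left fun x => ?_
    exact tailDeviation_le_integral_pairedTailDeviation hn hw hwm hz x
  refine hcopy.trans ?_
  have hinv : ∀ ε, ∫ q, pairedTailDeviation w z (signedSwap ε q) ∂Q =
      ∫ q, pairedTailDeviation w z q ∂Q := fun ε => by
    have h := measurePreserving_signedSwap (P := P) ε
    rw [← integral_map (φ := signedSwap ε) h.aemeasurable hpm.aestronglyMeasurable, h.map_eq]
  have hcard : (0 : ℝ) < Fintype.card (Fin n → ℤˣ) := by exact_mod_cast Fintype.card_pos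
  refine le_of_mul_le_mul_left ?_ hcard
  have hint : ∀ ε, Integrable (fun q => pairedTailDeviation w z (signedSwap ε q)) Q := fun ε =>
    integrable_of_abs_le (hpm.comp (measurePreserving_signedSwap (P := P) ε).measurable)
      fun _ => hpB _
  calc (Fintype.card (Fin n → ℤˣ) : ℝ) * ∫ q, pairedTailDeviation w z q ∂Q
      = ∑ ε, ∫ q, pairedTailDeviation w z (signedSwap ε q) ∂Q := by
        simp only [hinv, Finset.sum_const, nsmul_eq_mul, Finset.card_univ]
    _ = ∫ q, ∑ ε, pairedTailDeviation w z (signedSwap ε q) ∂Q :=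
        (integral_finsetSum _ fun ε _ => hint ε).symm
    _ ≤ ∫ _q, (Fintype.card (Fin n → ℤˣ) : ℝ) * (4 / √n) ∂Q :=
        integral_mono (integrable_finsetSum _ fun ε _ => hint ε) (integrable_const _) fun q =>
          sum_pairedTailDeviation_signedSwap_le hn hw z q
    _ = _ := by simp

end

/-! ### Residuals of an isotonic regression -/

/-- The first-order condition for isotonic regression. -/
theorem IsIsotonicRegression.sum_residual_mul_le {n : ℕ} {z : Fin n → unitInterval} {y : Fin n → ℝ}
    {h : unitInterval → unitInterval} (hh : IsIsotonicRegression z y h)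
    {g : unitInterval → ℝ} (hg : Monotone g) :
    ∑ i, (y i - h (z i)) * (g (z i) - h (z i)) ≤ 0 := by
  set R := ∑ i, (y i - h (z i)) * (g (z i) - h (z i)) with hR
  set D := ∑ i, (g (z i) - h (z i)) ^ 2 with hD
  have hD0 : 0 ≤ D := Finset.sum_nonneg fun i _ => sq_nonneg _
  have hhm : Monotone fun r => (h r : ℝ) := fun a b hab => hh.monotone hab
  have key : ∀ t : ℝ, 0 ≤ t → t ≤ 1 → 2 * t * R ≤ t ^ 2 * D := by
    intro t h0 h1
    have hm : Monotone fun r => (1 - t) * (h r : ℝ) + t * g r := fun a b hab =>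
      add_le_add (mul_le_mul_of_nonneg_left (hhm hab) (by linarith))
        (mul_le_mul_of_nonneg_left (hg hab) h0)
    have hle := hh.le_of_monotone _ hm
    have hexp : ∑ i, (y i - ((1 - t) * (h (z i) : ℝ) + t * g (z i))) ^ 2 =
        ∑ i, (y i - (h (z i) : ℝ)) ^ 2 - 2 * t * R + t ^ 2 * D := by
      rw [hR, hD, Finset.mul_sum, Finset.mul_sum, ← Finset.sum_sub_distrib,
        ← Finset.sum_add_distrib]
      exact Finset.sum_congr rfl fun i _ => by ring
    linarith
  by_contra! hpos
  have hDR : 0 < D + R := by linarith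
  -- If `R > 0`, this step size lies in `[0, 1]` even when `D = 0`, and it already contradicts
  -- minimality.
  have h1 := key (R / (D + R)) (by positivity) ((div_le_one hDR).2 (by linarith))
  have h2 : 2 * R * (D + R) ≤ R * D := by
    have : 2 * (R / (D + R)) * R * (D + R) ^ 2 ≤ (R / (D + R)) ^ 2 * D * (D + R) ^ 2 :=
      mul_le_mul_of_nonneg_right h1 (sq_nonneg _)
    field_simp at this
    nlinarith
  nlinarith [mul_nonneg hpos.le hD0]

/-- Both `h + (h - c)⁺` and `h - (h - c)⁺ = min h c` are monotone, so the first-order condition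
applies in both directions. -/
theorem IsIsotonicRegression.sum_residual_mul_posPart {n : ℕ} {z : Fin n → unitInterval}
    {y : Fin n → ℝ} {h : unitInterval → unitInterval} (hh : IsIsotonicRegression z y h) (c : ℝ) :
    ∑ i, (y i - h (z i)) * max ((h (z i) : ℝ) - c) 0 = 0 := by
  have hhm : Monotone fun r => (h r : ℝ) := fun a b hab => hh.monotone hab
  apply le_antisymm
  · have := hh.sum_residual_mul_le (g := fun r => (h r : ℝ) + max ((h r : ℝ) - c) 0)
      fun a b hab => add_le_add (hhm hab) (max_le_max_right _ (sub_le_sub_right (hhm hab) c))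
    simpa using this
  · have := hh.sum_residual_mul_le (g := fun r => min (h r : ℝ) c)
      fun a b hab => min_le_min_right _ (hhm hab)
    rw [← neg_nonpos, ← Finset.sum_neg_distrib]
    refine le_of_eq_of_le (Finset.sum_congr rfl fun i _ => ?_) this
    rw [← mul_neg]
    congr 1
    rcases le_total (h (z i) : ℝ) c with hc | hc
    · rw [min_eq_left hc, max_eq_right (by linarith)]
      ring
    · rw [min_eq_right hc, max_eq_left (by linarith)]
      ring

/-- With such a gap, the ramp `(v - b)⁺ - (v - a)⁺` equals `a - b` times the indicator of `U` at the
finitely many values concerned. This turns positive parts into indicators. -/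
theorem IsUpperSet.exists_gap {n : ℕ} {U : Set ℝ} (hU : IsUpperSet U) (v : Fin n → ℝ) :
    ∃ b a : ℝ, b < a ∧ (∀ i, v i ∈ U → a ≤ v i) ∧ ∀ i, v i ∉ U → v i ≤ b := by
  classical
  set lo := (Finset.univ.filter fun i => v i ∉ U).image v with hlo
  set hi := (Finset.univ.filter fun i => v i ∈ U).image v with hhi
  have hlt : ∀ r ∈ lo, ∀ s ∈ hi, r < s := by
    simp only [hlo, hhi, Finset.mem_image, Finset.mem_filter, Finset.mem_univ, true_and]
    rintro _ ⟨i, hi, rfl⟩ _ ⟨j, hj, rfl⟩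
    exact lt_of_not_ge fun hle => hi (hU hle hj)
  obtain ⟨b, hb1, hb2⟩ := Order.exists_between_finsets lo hi hlt
  obtain ⟨a, ha1, ha2⟩ := Order.exists_between_finsets {b} hi (by simpa using hb2)
  refine ⟨b, a, ha1 b (by simp), fun i hi => (ha2 _ ?_).le, fun i hi => (hb1 _ ?_).le⟩
  · exact Finset.mem_image_of_mem v (by simpa using hi)
  · exact Finset.mem_image_of_mem v (by simpa using hi)

/-- The residuals of an isotonic regression cancel where the fitted value is in an upper set. -/
theorem IsIsotonicRegression.sum_residual_mul_indicator {n : ℕ} {z : Fin n → unitInterval}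
    {y : Fin n → ℝ} {h : unitInterval → unitInterval} (hh : IsIsotonicRegression z y h)
    {U : Set ℝ} (hU : IsUpperSet U) :
    ∑ i, (y i - h (z i)) * U.indicator (fun _ => (1 : ℝ)) (h (z i)) = 0 := by
  obtain ⟨b, a, hba, hin, hout⟩ := hU.exists_gap fun i => (h (z i) : ℝ)
  have hsum : ∑ i, (y i - h (z i)) * U.indicator (fun _ => (1 : ℝ)) (h (z i)) * (a - b) = 0 := by
    have := congrArg₂ (· - ·) (hh.sum_residual_mul_posPart b) (hh.sum_residual_mul_posPart a)
    simp only [← Finset.sum_sub_distrib, sub_zero] at this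
    rw [← this]
    refine Finset.sum_congr rfl fun i _ => ?_
    rw [mul_assoc, ← mul_sub]
    congr 1
    by_cases hi : (h (z i) : ℝ) ∈ U
    · have := hin i hi
      rw [Set.indicator_of_mem hi, max_eq_left (by linarith), max_eq_left (by linarith)]
      ring
    · have := hout i hi
      rw [Set.indicator_of_notMem hi, max_eq_right (by linarith), max_eq_right (by linarith)]
      ring
  rw [← Finset.sum_mul] at hsum
  exact (mul_eq_zero.1 hsum).resolve_right (sub_ne_zero.2 hba.ne')

/-! ### From rational half-lines to upper sets and monotone functions -/

open Filter Topology in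
/-- Upper sets of the line are pointwise limits of open rational half-lines. -/
theorem IsUpperSet.exists_seq_rat {U : Set ℝ} (hU : IsUpperSet U) :
    ∃ q : ℕ → ℚ, ∀ t, ∀ᶠ k in atTop, ((q k : ℝ) < t ↔ t ∈ U) := by
  rcases U.eq_empty_or_nonempty with rfl | hne
  · refine ⟨fun k => k, fun t => ?_⟩
    filter_upwards [tendsto_natCast_atTop_atTop.eventually_ge_atTop t] with k hk
    simpa using hk
  by_cases hbdd : BddBelow U
  · have hIoi : ∀ t, sInf U < t → t ∈ U := fun t ht => by
      obtain ⟨u, hu, hut⟩ := exists_lt_of_csInf_lt hne ht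
      exact hU hut.le hu
    have hle : ∀ t ∈ U, sInf U ≤ t := fun t ht => csInf_le hbdd ht
    -- A closed half-line is approached by thresholds from strictly below its endpoint, an open one
    -- from strictly above.
    by_cases hmem : sInf U ∈ U
    · obtain ⟨q, -, hq, hlim⟩ := Real.exists_seq_rat_strictMono_tendsto (sInf U)
      refine ⟨q, fun t => ?_⟩
      by_cases ht : t ∈ U
      · exact Eventually.of_forall fun k => by simpa [ht] using (hq k).trans_le (hle t ht)
      · have hlt : t < sInf U := lt_of_not_ge fun h => ht (hU h hmem)
        filter_upwards [hlim.eventually (lt_mem_nhds hlt)] with k hk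
        simpa [ht] using hk.le
    · obtain ⟨q, -, hq, hlim⟩ := Real.exists_seq_rat_strictAnti_tendsto (sInf U)
      refine ⟨q, fun t => ?_⟩
      by_cases ht : t ∈ U
      · have hlt : sInf U < t := (hle t ht).lt_of_ne fun h => hmem (h ▸ ht)
        filter_upwards [hlim.eventually (gt_mem_nhds hlt)] with k hk
        simpa [ht] using hk
      · have : t ≤ sInf U := le_of_not_gt fun h => ht (hIoi t h)
        exact Eventually.of_forall fun k => by simpa [ht] using this.trans (hq k).le
  · refine ⟨fun k => -k, fun t => ?_⟩
    have ht : t ∈ U := by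
      obtain ⟨u, hu, hut⟩ := not_bddBelow_iff.1 hbdd t
      exact hU hut.le hu
    filter_upwards [tendsto_natCast_atTop_atTop.eventually_gt_atTop (-t)] with k hk
    simpa [ht] using neg_lt.1 hk

section

variable {S : Type*} [MeasurableSpace S] {P : Measure S} [IsProbabilityMeasure P] {n : ℕ}

open Filter Topology in
-- Rational thresholds keep the supremum countable, hence measurable; dominated convergence recovers
-- every upper set from them.
theorem abs_empiricalDeviation_indicator_le {w z : S → ℝ}
    (hw : ∀ s, w s ∈ Set.Icc (0 : ℝ) 1) (hwm : Measurable w) (hz : Measurable z)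
    {U : Set ℝ} (hU : IsUpperSet U) (x : Fin n → S) :
    |empiricalDeviation P ((z ⁻¹' U).indicator w) x| ≤ tailDeviation P w z x := by
  obtain ⟨q, hq⟩ := hU.exists_seq_rat
  have hpt : ∀ s, Tendsto (fun k => (z ⁻¹' Set.Ioi (q k : ℝ)).indicator w s) atTop
      (𝓝 ((z ⁻¹' U).indicator w s)) := fun s => by
    refine tendsto_const_nhds.congr' ?_
    filter_upwards [hq (z s)] with k hk
    by_cases h : z s ∈ U
    · simp [h, hk.2 h]
    · have := hk.not.2 h
      simp [h, this]
  have hlim : Tendsto (fun k => |empiricalDeviation P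
      ((z ⁻¹' Set.Ioi (q k : ℝ)).indicator w) x|) atTop
      (𝓝 |empiricalDeviation P ((z ⁻¹' U).indicator w) x|) := by
    refine (Tendsto.sub ?_ ?_).abs
    · exact (tendsto_finsetSum _ fun i _ => hpt (x i)).div_const _
    · refine tendsto_integral_of_dominated_convergence (fun _ => 1) (fun k => ?_)
        (integrable_const _) (fun k => ?_) (Eventually.of_forall hpt)
      · exact (hwm.indicator (hz measurableSet_Ioi)).aestronglyMeasurable
      · exact Eventually.of_forall (abs_indicator_le_one hw _)
  exact le_of_tendsto hlim (Eventually.of_forall fun k =>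
    abs_empiricalDeviation_le_tailDeviation hw z x (q k))

theorem setIntegral_Ioc_indicator_Ioi {r : ℝ} (hr : r ∈ Set.Icc (0 : ℝ) 1) :
    ∫ t in Set.Ioc (0 : ℝ) 1, (if t < r then (1 : ℝ) else 0) = r := by
  have h : (fun t : ℝ => if t < r then (1 : ℝ) else 0) = (Set.Iio r).indicator 1 := by
    ext t
    simp [Set.indicator_apply]
  have h2 : Set.Iio r ∩ Set.Ioc (0 : ℝ) 1 = Set.Ioo 0 r := by
    ext t
    simp only [Set.mem_inter_iff, Set.mem_Iio, Set.mem_Ioc, Set.mem_Ioo]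
    exact ⟨fun h => ⟨h.2.1, h.1⟩, fun h => ⟨h.2, h.1, h.2.le.trans hr.2⟩⟩
  rw [h, integral_indicator_one measurableSet_Iio, measureReal_restrict_apply measurableSet_Iio,
    h2, Real.volume_real_Ioo_of_le hr.1, sub_zero]

/-- The layer-cake formula transfers tail bounds to monotone functions. -/
theorem abs_empiricalDeviation_monotone_le {z : S → ℝ} (hz : Measurable z) {G : ℝ → ℝ}
    (hG : Monotone G) (hG01 : ∀ r, G r ∈ Set.Icc (0 : ℝ) 1) (x : Fin n → S) :
    |empiricalDeviation P (fun s => G (z s)) x| ≤ tailDeviation P (fun _ => 1) z x := by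
  set ν : Measure ℝ := volume.restrict (Set.Ioc 0 1) with hν
  have : IsProbabilityMeasure ν := ⟨by simp [hν]⟩
  let k : S → ℝ → ℝ := fun s t => if t < G (z s) then 1 else 0
  have hk1 : ∀ s t, |k s t| ≤ 1 := fun s t => by
    by_cases h : t < G (z s) <;> simp [k, h]
  have hkm : Measurable (Function.uncurry k) :=
    Measurable.ite (measurableSet_lt measurable_snd
      ((hG.measurable.comp hz).comp measurable_fst)) measurable_const measurable_const
  have hkG : ∀ s, ∫ t, k s t ∂ν = G (z s) := fun s => setIntegral_Ioc_indicator_Ioi (hG01 _)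
  have hkt : ∀ t, (fun s => k s t) = (z ⁻¹' {r | t < G r}).indicator fun _ => 1 := fun t => by
    ext s
    by_cases h : t < G (z s) <;> simp [k, h]
  have hks : ∀ s, Integrable (k s) ν := fun s =>
    integrable_of_abs_le (hkm.comp measurable_prodMk_left) (hk1 s)
  have hint : Integrable (Function.uncurry k) (P.prod ν) :=
    integrable_of_abs_le hkm fun p => hk1 p.1 p.2
  have hswap : ∫ s, G (z s) ∂P = ∫ t, ∫ s, k s t ∂P ∂ν := by
    rw [← integral_integral_swap hint]
    simp_rw [hkG]
  have hdev : empiricalDeviation P (fun s => G (z s)) x =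
      ∫ t, empiricalDeviation P ((z ⁻¹' {r | t < G r}).indicator fun _ => 1) x ∂ν := by
    simp_rw [← hkt]
    unfold empiricalDeviation
    rw [integral_sub, integral_div, integral_finsetSum, hswap]
    · simp_rw [hkG]
    · exact fun i _ => hks _
    · exact (integrable_finsetSum _ fun i _ => hks (x i)).div_const _
    · exact hint.integral_prod_right
  rw [hdev]
  refine abs_integral_le_of_abs_le fun t => ?_
  exact abs_empiricalDeviation_indicator_le (fun _ => ⟨zero_le_one, le_rfl⟩) measurable_const hz
    (fun a b hab ha => lt_of_lt_of_le ha (hG hab)) x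

end

/-! ### Deterministic bound for the calibration error -/

/-- Truncation to the unit interval. -/
noncomputable def clampUnit (y : ℝ) : ℝ := max 0 (min 1 y)

theorem clampUnit_mem (y : ℝ) : clampUnit y ∈ Set.Icc (0 : ℝ) 1 :=
  ⟨le_max_left _ _, max_le zero_le_one (min_le_left _ _)⟩

theorem clampUnit_of_mem {y : ℝ} (hy : y ∈ Set.Icc (0 : ℝ) 1) : clampUnit y = y := by
  rw [clampUnit, min_eq_right hy.2, max_eq_right hy.1]

theorem measurable_clampUnit : Measurable clampUnit := by
  unfold clampUnit
  fun_prop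

/-- The sum of the tail deviations of the predictor and of the truncated response. -/
noncomputable def totalTailDeviation {𝒳 : Type*} [MeasurableSpace 𝒳] (P : Measure (𝒳 × ℝ))
    (f : 𝒳 → unitInterval) {n : ℕ} (x : Fin n → 𝒳 × ℝ) : ℝ :=
  tailDeviation P (fun _ => 1) (fun p => (f p.1 : ℝ)) x +
    tailDeviation P (fun p => clampUnit p.2) (fun p => (f p.1 : ℝ)) x

section

variable {𝒳 : Type*} [MeasurableSpace 𝒳] {P : Measure (𝒳 × ℝ)} [IsProbabilityMeasure P]
  {f : 𝒳 → unitInterval} {n : ℕ} {x : Fin n → 𝒳 × ℝ} {h : unitInterval → unitInterval}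

theorem measurable_of_monotone_unitInterval (hh : Monotone h) (hf : Measurable f) :
    Measurable fun p : 𝒳 × ℝ => (h (f p.1) : ℝ) :=
  measurable_subtype_coe.comp (hh.measurable.comp (hf.comp measurable_fst))

/-- Since the empirical residual sum over the set vanishes, the integral is the difference of two
empirical deviations, one for the response and one for the fitted value. -/
theorem abs_integral_residual_upperSet_le (hP : ∀ᵐ p ∂P, p.2 ∈ Set.Icc (0 : ℝ) 1)
    (hf : Measurable f) (hx : ∀ i, (x i).2 ∈ Set.Icc (0 : ℝ) 1)
    (hh : IsIsotonicRegression (fun i => f (x i).1) (fun i => (x i).2) h)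
    {U : Set ℝ} (hU : IsUpperSet U) :
    |∫ p : 𝒳 × ℝ, (p.2 - h (f p.1)) * U.indicator (fun _ => (1 : ℝ)) (h (f p.1)) ∂P| ≤
      totalTailDeviation P f x := by
  set z : 𝒳 × ℝ → ℝ := fun p => (f p.1 : ℝ) with hz
  have hzm : Measurable z := measurable_subtype_coe.comp (hf.comp measurable_fst)
  let H : ℝ → ℝ := Set.IccExtend zero_le_one fun r => (h r : ℝ)
  have hHm : Monotone H := Monotone.IccExtend _ fun a b hab => hh.monotone hab
  have hH01 : ∀ r, H r ∈ Set.Icc (0 : ℝ) 1 := fun r => (h _).2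
  have hHz : ∀ p, H (z p) = h (f p.1) := fun p => Set.IccExtend_val _ _ _
  set V : Set ℝ := H ⁻¹' U with hV
  have hVU : IsUpperSet V := fun a b hab ha => hU (hHm hab) ha
  -- Responses lie in `[0, 1]` only almost surely, while the deviation bounds need a weight bounded
  -- everywhere. Truncation changes neither the sample nor the integral.
  let w : 𝒳 × ℝ → ℝ := fun p => clampUnit p.2
  have hw : ∀ p, w p ∈ Set.Icc (0 : ℝ) 1 := fun p => clampUnit_mem _
  have hwm : Measurable w := measurable_clampUnit.comp measurable_snd
  -- Cutting off below an upper set keeps `H` monotone because `H ≥ 0`.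
  let G : ℝ → ℝ := V.indicator H
  have hG01 : ∀ r, G r ∈ Set.Icc (0 : ℝ) 1 := indicator_mem_Icc hH01 V
  have hGm : Monotone G := fun a b hab => by
    by_cases ha : a ∈ V
    · simpa [G, ha, hVU hab ha] using hHm hab
    · simpa [G, ha] using (hG01 b).1
  have hterm : ∀ p : 𝒳 × ℝ, p.2 ∈ Set.Icc (0 : ℝ) 1 →
      (p.2 - h (f p.1)) * U.indicator (fun _ => (1 : ℝ)) (h (f p.1)) =
        (z ⁻¹' V).indicator w p - G (z p) := by
    intro p hp
    by_cases hpU : (h (f p.1) : ℝ) ∈ U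
    · have h1 : z p ∈ V := by simpa [hV, hHz] using hpU
      rw [Set.indicator_of_mem hpU, Set.indicator_of_mem (by exact h1)]
      simp [G, h1, hHz, w, clampUnit_of_mem hp]
    · have h1 : z p ∉ V := by simpa [hV, hHz] using hpU
      rw [Set.indicator_of_notMem hpU, Set.indicator_of_notMem (by exact h1)]
      simp [G, h1]
  have hwi : Integrable ((z ⁻¹' V).indicator w) P :=
    integrable_of_abs_le (hwm.indicator (hzm (hHm.measurable hU.ordConnected.measurableSet)))
      (abs_indicator_le_one hw _)
  have hGi : Integrable (fun p => G (z p)) P :=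
    integrable_of_abs_le (hGm.measurable.comp hzm) fun p =>
      abs_le.2 ⟨by linarith [(hG01 (z p)).1], (hG01 (z p)).2⟩
  have hsum : ∑ i, (z ⁻¹' V).indicator w (x i) = ∑ i, G (z (x i)) := by
    rw [← sub_eq_zero, ← Finset.sum_sub_distrib, ← hh.sum_residual_mul_indicator hU]
    exact Finset.sum_congr rfl fun i _ => (hterm (x i) (hx i)).symm
  have hint : ∫ p : 𝒳 × ℝ, (p.2 - h (f p.1)) * U.indicator (fun _ => (1 : ℝ)) (h (f p.1)) ∂P =
      empiricalDeviation P (fun p => G (z p)) x -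
        empiricalDeviation P ((z ⁻¹' V).indicator w) x := by
    rw [integral_congr_ae (hP.mono hterm), integral_sub hwi hGi, empiricalDeviation,
      empiricalDeviation, hsum]
    ring
  rw [hint]
  exact (abs_sub _ _).trans (add_le_add (abs_empiricalDeviation_monotone_le hzm hGm hG01 x)
    (abs_empiricalDeviation_indicator_le hw hwm hzm hVU x))

theorem cutoffCalibrationError_le (hP : ∀ᵐ p ∂P, p.2 ∈ Set.Icc (0 : ℝ) 1)
    (hf : Measurable f) (hx : ∀ i, (x i).2 ∈ Set.Icc (0 : ℝ) 1)
    (hh : IsIsotonicRegression (fun i => f (x i).1) (fun i => (x i).2) h) :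
    cutoffCalibrationError P (fun a => (h (f a) : ℝ)) ≤ 2 * totalTailDeviation P f x := by
  have : Nonempty {I : Set ℝ // I.OrdConnected} := ⟨⟨∅, Set.ordConnected_empty⟩⟩
  refine ciSup_le fun ⟨I, hI⟩ => ?_
  -- An interval `I` is `U \ (U \ I)`, and order-connectedness makes `U \ I` an upper set as well.
  set U : Set ℝ := (upperClosure I : Set ℝ) with hUdef
  have hU : IsUpperSet U := (upperClosure I).upper
  have hIU : I ⊆ U := subset_upperClosure
  have hV : IsUpperSet (U \ I) := by
    rintro a b hab ⟨haU, haI⟩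
    refine ⟨hU hab haU, fun hbI => haI ?_⟩
    obtain ⟨c, hc, hca⟩ := mem_upperClosure.1 haU
    exact hI.out hc hbI ⟨hca, hab⟩
  have hm : Measurable fun p : 𝒳 × ℝ => (h (f p.1) : ℝ) :=
    measurable_of_monotone_unitInterval hh.monotone hf
  have hint : ∀ A : Set ℝ, IsUpperSet A → Integrable (fun p : 𝒳 × ℝ =>
      (p.2 - h (f p.1)) * A.indicator (fun _ => (1 : ℝ)) (h (f p.1))) P := by
    intro A hA
    have hAm : Measurable (A.indicator fun _ => (1 : ℝ)) :=
      measurable_const.indicator hA.ordConnected.measurableSet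
    refine Integrable.of_bound ((measurable_snd.sub hm).mul (hAm.comp hm)).aestronglyMeasurable 1 ?_
    filter_upwards [hP] with p hp
    have h1 : |A.indicator (fun _ => (1 : ℝ)) (h (f p.1) : ℝ)| ≤ 1 :=
      abs_indicator_le_one (fun _ => ⟨zero_le_one, le_rfl⟩) A _
    have h2 : |p.2 - h (f p.1)| ≤ 1 := abs_le.2
      ⟨by linarith [hp.1, (h (f p.1)).2.2], by linarith [hp.2, (h (f p.1)).2.1]⟩
    rw [norm_mul, Real.norm_eq_abs, Real.norm_eq_abs]
    exact mul_le_one₀ h2 (abs_nonneg _) h1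
  have hsplit : ∫ p : 𝒳 × ℝ, (p.2 - h (f p.1)) * I.indicator (fun _ => (1 : ℝ)) (h (f p.1)) ∂P =
      ∫ p : 𝒳 × ℝ, (p.2 - h (f p.1)) * U.indicator (fun _ => (1 : ℝ)) (h (f p.1)) ∂P -
      ∫ p : 𝒳 × ℝ, (p.2 - h (f p.1)) * (U \ I).indicator (fun _ => (1 : ℝ)) (h (f p.1)) ∂P := by
    rw [← integral_sub (hint U hU) (hint _ hV)]
    congr 1 with p
    by_cases hpI : (h (f p.1) : ℝ) ∈ I
    · simp [hpI, hIU hpI]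
    · by_cases hpU : (h (f p.1) : ℝ) ∈ U <;> simp [hpI, hpU]
  change |∫ p : 𝒳 × ℝ, (p.2 - h (f p.1)) * I.indicator (fun _ => (1 : ℝ)) (h (f p.1)) ∂P| ≤ _
  rw [hsplit, two_mul]
  exact (abs_sub _ _).trans (add_le_add (abs_integral_residual_upperSet_le hP hf hx hh hU)
    (abs_integral_residual_upperSet_le hP hf hx hh hV))

end

/-! ### Concentration and conclusion -/

section

variable {𝒳 : Type*} [MeasurableSpace 𝒳] {P : Measure (𝒳 × ℝ)} {f : 𝒳 → unitInterval} {n : ℕ}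

theorem measurable_totalTailDeviation (hf : Measurable f) :
    Measurable fun x : Fin n → 𝒳 × ℝ => totalTailDeviation P f x :=
  (measurable_tailDeviation measurable_const
    (measurable_subtype_coe.comp (hf.comp measurable_fst))).add
  (measurable_tailDeviation (measurable_clampUnit.comp measurable_snd)
    (measurable_subtype_coe.comp (hf.comp measurable_fst)))

variable [IsProbabilityMeasure P]

theorem integral_totalTailDeviation_le (hf : Measurable f) (hn : 0 < n) :
    ∫ x, totalTailDeviation P f x ∂(Measure.pi fun _ : Fin n => P) ≤ 8 / √n := by
  have hz : Measurable fun p : 𝒳 × ℝ => (f p.1 : ℝ) :=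
    measurable_subtype_coe.comp (hf.comp measurable_fst)
  have h1 : ∀ _p : 𝒳 × ℝ, (1 : ℝ) ∈ Set.Icc (0 : ℝ) 1 := fun _ => ⟨zero_le_one, le_rfl⟩
  have hc : Measurable fun p : 𝒳 × ℝ => clampUnit p.2 := measurable_clampUnit.comp measurable_snd
  have hw : ∀ p : 𝒳 × ℝ, clampUnit p.2 ∈ Set.Icc (0 : ℝ) 1 := fun p => clampUnit_mem p.2
  have hi₁ : Integrable (fun x : Fin n → 𝒳 × ℝ => tailDeviation P (fun _ => 1)
      (fun p => (f p.1 : ℝ)) x) (Measure.pi fun _ => P) :=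
    integrable_of_abs_le (measurable_tailDeviation measurable_const hz)
      (abs_tailDeviation_le_two h1 _)
  have hi₂ : Integrable (fun x : Fin n → 𝒳 × ℝ => tailDeviation P (fun p => clampUnit p.2)
      (fun p => (f p.1 : ℝ)) x) (Measure.pi fun _ => P) :=
    integrable_of_abs_le (measurable_tailDeviation hc hz) (abs_tailDeviation_le_two hw _)
  have h₁ := integral_tailDeviation_le (P := P) hn h1 measurable_const hz
  have h₂ := integral_tailDeviation_le (P := P) hn hw hc hz
  calc ∫ x, totalTailDeviation P f x ∂(Measure.pi fun _ : Fin n => P) = _ := integral_add hi₁ hi₂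
    _ ≤ 4 / √n + 4 / √n := add_le_add h₁ h₂
    _ = 8 / √n := by ring

/-- Each of the two suprema has differences at most `1 / n`, so `c = 2 / n`. With `ε = √(2L) / √n`
the McDiarmid exponent `2 ε² / (n c²)` is exactly `L`. -/
theorem measureReal_totalTailDeviation_ge_le (hf : Measurable f) (hn : 0 < n) {L : ℝ}
    (hL : 0 ≤ L) :
    (Measure.pi fun _ : Fin n => P).real
      {x | √(2 * L) / √n ≤ totalTailDeviation P f x -
        ∫ y, totalTailDeviation P f y ∂Measure.pi fun _ : Fin n => P} ≤ Real.exp (-L) := by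
  have h1 : ∀ _p : 𝒳 × ℝ, (1 : ℝ) ∈ Set.Icc (0 : ℝ) 1 := fun _ => ⟨zero_le_one, le_rfl⟩
  have hn' : (0 : ℝ) < n := by exact_mod_cast hn
  refine (measureReal_ge_le_of_bounded_differences P (c := 2 / n) (B := 4) hn (by positivity)
    (by positivity) (measurable_totalTailDeviation hf) (fun x => ?_) fun x i s => ?_).trans_eq ?_
  · refine (abs_add_le _ _).trans ?_
    linarith [abs_tailDeviation_le_two (P := P) h1 (fun p => (f p.1 : ℝ)) x,
      abs_tailDeviation_le_two (P := P) (fun p : 𝒳 × ℝ => clampUnit_mem p.2)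
        (fun p => (f p.1 : ℝ)) x]
  · rw [totalTailDeviation, totalTailDeviation, add_sub_add_comm]
    refine (abs_add_le _ _).trans ?_
    have h2 := abs_tailDeviation_update_sub_le (P := P) h1 (fun p => (f p.1 : ℝ)) x i s
    have h3 := abs_tailDeviation_update_sub_le (P := P)
      (fun p : 𝒳 × ℝ => clampUnit_mem p.2) (fun p => (f p.1 : ℝ)) x i s
    calc _ ≤ 1 / (n : ℝ) + 1 / n := add_le_add h2 h3
      _ = 2 / n := by ring
  · rw [div_pow, Real.sq_sqrt (by positivity), Real.sq_sqrt hn'.le]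
    congr 1
    field_simp

end

theorem proposition5p1 {𝒳 Ω : Type*} [MeasurableSpace 𝒳] [MeasurableSpace Ω]
    (P : Measure (𝒳 × ℝ)) [IsProbabilityMeasure P]
    (hP : ∀ᵐ p ∂P, p.2 ∈ Set.Icc (0 : ℝ) 1)
    (f : 𝒳 → unitInterval) (hf : Measurable f)
    (μ : Measure Ω) [IsProbabilityMeasure μ]
    (n : ℕ) (hn : 0 < n) (X : Fin n → Ω → 𝒳) (Y : Fin n → Ω → ℝ)
    (hlaw : ∀ i, HasLaw (fun ω => (X i ω, Y i ω)) P μ)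
    (hindep : iIndepFun (fun i ω => (X i ω, Y i ω)) μ)
    (δ : ℝ) (hδ : 0 < δ) :
    ∃ E : Set Ω, MeasurableSet E ∧ ENNReal.ofReal (1 - δ) ≤ μ E ∧
      ∀ ω ∈ E, ∀ h : unitInterval → unitInterval,
        IsIsotonicRegression (fun i => f (X i ω)) (fun i => Y i ω) h →
          cutoffCalibrationError P (fun x => (h (f x) : ℝ)) ≤
            (30 + 2 * √(2 * Real.log (2 / δ))) / √(n : ℝ) := by
  rcases le_or_gt 1 δ with hδ1 | hδ1
  · exact ⟨∅, MeasurableSet.empty, by simp [hδ1], fun ω hω => hω.elim⟩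
  set L := Real.log (2 / δ) with hLdef
  have hL : 0 ≤ L := Real.log_nonneg (by rw [le_div_iff₀ hδ]; linarith)
  have hexp : Real.exp (-L) = δ / 2 := by
    rw [Real.exp_neg, hLdef, Real.exp_log (by positivity), inv_div]
  let T : Ω → Fin n → 𝒳 × ℝ := fun ω i => (X i ω, Y i ω)
  have hT : AEMeasurable T μ := aemeasurable_pi_lambda _ fun i => (hlaw i).aemeasurable
  have hmap : μ.map T = Measure.pi fun _ => P := by
    have := (iIndepFun_iff_map_fun_eq_pi_map fun i => (hlaw i).aemeasurable).1 hindep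
    simpa only [(hlaw _).map_eq] using this
  set m := ∫ y, totalTailDeviation P f y ∂Measure.pi fun _ : Fin n => P with hm
  set bad : Set (Fin n → 𝒳 × ℝ) := {x | √(2 * L) / √n ≤ totalTailDeviation P f x - m} with hbad
  have hbadm : MeasurableSet bad :=
    measurableSet_le measurable_const ((measurable_totalTailDeviation hf).sub_const _)
  have hbadμ : (Measure.pi fun _ : Fin n => P).real bad ≤ δ / 2 :=
    (measureReal_totalTailDeviation_ge_le hf hn hL).trans_eq hexp
  have hgoodμ : ENNReal.ofReal (1 - δ) ≤ μ (T ⁻¹' badᶜ) := by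
    rw [← Measure.map_apply_of_aemeasurable hT hbadm.compl, hmap, ← ofReal_measureReal,
      probReal_compl_eq_one_sub hbadm]
    exact ENNReal.ofReal_le_ofReal (by linarith)
  have hY : ∀ᵐ ω ∂μ, ∀ i, Y i ω ∈ Set.Icc (0 : ℝ) 1 := by
    refine ae_all_iff.2 fun i => ?_
    have h := hP
    rw [← (hlaw i).map_eq] at h
    exact ae_of_ae_map (hlaw i).aemeasurable h
  -- The sample map is only a.e. measurable and the responses are in range only almost surely, so
  -- the good event is null-measurable; `E` is a measurable subset of full measure in it.
  have hset : (T ⁻¹' badᶜ ∩ {ω | ∀ i, Y i ω ∈ Set.Icc (0 : ℝ) 1} : Set Ω) =ᵐ[μ] T ⁻¹' badᶜ :=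
    inter_ae_eq_left_of_ae_eq_univ (Filter.eventuallyEq_univ.2 hY)
  have hnull : NullMeasurableSet (T ⁻¹' badᶜ ∩ {ω | ∀ i, Y i ω ∈ Set.Icc (0 : ℝ) 1}) μ :=
    (hT.nullMeasurableSet_preimage hbadm.compl).congr hset.symm
  obtain ⟨E, hEsub, hE, hEeq⟩ := hnull.exists_measurable_subset_ae_eq
  refine ⟨E, hE, ?_, fun ω hω h hh => ?_⟩
  · rwa [measure_congr hEeq, measure_congr hset]
  · obtain ⟨hωT, hωY⟩ := hEsub hω
    have hlt : totalTailDeviation P f (T ω) - m < √(2 * L) / √n := not_le.1 hωT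
    have hmle : m ≤ 8 / √n := integral_totalTailDeviation_le hf hn
    have hdet := cutoffCalibrationError_le (x := T ω) hP hf hωY hh
    have hsqrt : 0 ≤ 1 / √(n : ℝ) := by positivity
    -- The argument uses `16 = 2 · 8` of the constant `30`; the remaining `14` is slack.
    have hsplit : (30 + 2 * √(2 * L)) / √(n : ℝ) =
        2 * (8 / √n) + 2 * (√(2 * L) / √n) + 14 * (1 / √n) := by ring
    rw [hsplit]
    linarith
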